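/- Let $G$ be a finite group, let $p$ be the smallest prime divisor of $|G|$, and let $S$ be a Sylow $p$-subgroup of $G$. Suppose that $\exp(S)=p$ and that every minimal subgroup of $S$ (that is, every minimal nontrivial subgroup of $S$) is weakly $S\Phi$-supplemented in $G$. Then the fusion system $\mathcal{F}_S(G)$ is supersolvable. Here the following terms are used. - A subgroup $B$ of $G$ is $S$-permutable in $G$ if $BQ=QB$ for all Sylow subgroups $Q$ of $G$ (for all primes). For $A\le G$, $A_{sG}$ is the subgroup generated by all subgroups of $A$ that are $S$-permutable in $G$, and $\Phi(A)$ is the Frattini subgroup of $A$. The subgroup $A$ is weakly $S\Phi$-supplemented in $G$ if there is a subgroup $T\le G$ with $G=AT$ and $A\cap T\le \Phi(A)A_{sG}$. - $\mathcal{F}_S(G)$ is the category whose objects are the subgroups of $S$ and whose morphisms $P\to Q$ are the maps $x\mapsto x^g=g^{-1}xg$ with $g\in G$ and $P^g\le Q$. - For $\mathcal{F}=\mathcal{F}_S(G)$, a subgroup $P\le S$ is strongly $\mathcal{F}$-closed if $\varphi(R)\le P$ for every $R\le P$ and every morphism $\varphi:R\to S$ of $\mathcal{F}$. The system $\mathcal{F}$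 is supersolvable if there is a series $1=S_0\le S_1\le\cdots\le S_n=S$ of strongly $\mathcal{F}$-closed subgroups such that $S_{i+1}/S_i$ is cyclic for $i=0,\dots,n-1$. -/

import Mathlib

open scoped Pointwise

/-- A subgroup `A` of `G` is `S`-permutable in `G` if `AQ = QA` (as products of sets) for all
Sylow subgroups `Q` of `G`, for all primes. -/
def Subgroup.IsSPermutable {G : Type*} [Group G] (A : Subgroup G) : Prop :=
  ∀ q : ℕ, q.Prime → ∀ Q : Sylow q G,
    (A : Set G) * ((Q : Subgroup G) : Set G) = ((Q : Subgroup G) : Set G) * (A : Set G)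

/-- `A_{sG}`: the subgroup generated by all subgroups of `A` that are `S`-permutable in `G`. -/
def Subgroup.sPermCore {G : Type*} [Group G] (A : Subgroup G) : Subgroup G :=
  sSup {B : Subgroup G | B ≤ A ∧ B.IsSPermutable}

/-- `Φ(A)`, the Frattini subgroup of `A`, viewed as a subgroup of the ambient group `G`. -/
def Subgroup.frattiniIn {G : Type*} [Group G] (A : Subgroup G) : Subgroup G :=
  (frattini A).map A.subtype

/-- `A` is weakly `SΦ`-supplemented in `G`: there is a subgroup `T` of `G` with `G = AT` and
`A ∩ T ≤ Φ(A) A_{sG}` (both products are products of sets). -/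
def Subgroup.IsWeaklySPhiSupplemented {G : Type*} [Group G] (A : Subgroup G) : Prop :=
  ∃ T : Subgroup G, (A : Set G) * (T : Set G) = Set.univ ∧
    ((A ⊓ T : Subgroup G) : Set G) ⊆ (A.frattiniIn : Set G) * (A.sPermCore : Set G)

/-- A fusion system over a group `S` (in practice a finite `p`-group): a category whose objects are
the subgroups of `S` and whose morphisms are injective homomorphisms, containing all morphisms
induced by conjugation in `S` (in particular inclusions and identities), and such that each
morphism is an isomorphism of the category followed by an inclusion. -/
structure FusionSystem (S : Type*) [Group S] where
  /-- The set of morphisms from `P` to `Q`. -/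
  Hom (P Q : Subgroup S) : Set (P →* Q)
  injective_of_mem : ∀ {P Q : Subgroup S} {φ : P →* Q}, φ ∈ Hom P Q → Function.Injective φ
  conj_mem : ∀ {P Q : Subgroup S} (s : S) (φ : P →* Q),
    (∀ x : P, (φ x : S) = s⁻¹ * (x : S) * s) → φ ∈ Hom P Q
  comp_mem : ∀ {P Q R : Subgroup S} {φ : P →* Q} {ψ : Q →* R},
    φ ∈ Hom P Q → ψ ∈ Hom Q R → ψ.comp φ ∈ Hom P R
  exists_factor : ∀ {P Q : Subgroup S} {φ : P →* Q}, φ ∈ Hom P Q →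
    ∃ (R : Subgroup S) (hR : R ≤ Q) (e : P ≃* R), e.toMonoidHom ∈ Hom P R ∧
      e.symm.toMonoidHom ∈ Hom R P ∧ φ = (Subgroup.inclusion hR).comp e.toMonoidHom

namespace FusionSystem

/-- The fusion system `F_S(G)` of `G` over a subgroup `S` (in practice a Sylow `p`-subgroup): the
morphisms `P → Q` are the maps `x ↦ x ^ g = g⁻¹ x g`, for `g` in `G` with `P ^ g ≤ Q`. -/
def ofSubgroup {G : Type*} [Group G] (S : Subgroup G) : FusionSystem S where
  Hom P Q := {φ | ∃ g : G, ∀ x : P, ((φ x : S) : G) = g⁻¹ * ((x : S) : G) * g}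
  injective_of_mem := by
    rintro P Q φ ⟨g, hg⟩ x y hxy
    have h := (hg x).symm.trans ((congrArg (fun z : Q => ((z : S) : G)) hxy).trans (hg y))
    exact Subtype.ext (Subtype.ext (mul_left_cancel (mul_right_cancel h)))
  conj_mem := by
    intro P Q s φ h
    exact ⟨(s : G), fun x => by rw [h x]; simp⟩
  comp_mem := by
    rintro P Q R φ ψ ⟨g, hg⟩ ⟨k, hk⟩
    refine ⟨g * k, fun x => ?_⟩
    rw [MonoidHom.comp_apply, hk, hg]
    group
  exists_factor := by
    rintro P Q φ ⟨g, hg⟩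
    have hinj : Function.Injective (Q.subtype.comp φ) := by
      intro x y hxy
      have h := (hg x).symm.trans ((congrArg (fun z : S => (z : G)) hxy).trans (hg y))
      exact Subtype.ext (Subtype.ext (mul_left_cancel (mul_right_cancel h)))
    refine ⟨(Q.subtype.comp φ).range, ?_, MonoidHom.ofInjective hinj, ⟨g, fun x => hg x⟩,
      ⟨g⁻¹, fun y => ?_⟩, rfl⟩
    · rintro _ ⟨x, rfl⟩
      exact (φ x).2
    · obtain ⟨x, rfl⟩ := (MonoidHom.ofInjective hinj).surjective y
      have h1 : (MonoidHom.ofInjective hinj).symm.toMonoidHom (MonoidHom.ofInjective hinj x) = x :=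
        (MonoidHom.ofInjective hinj).symm_apply_apply x
      have h2 : ((MonoidHom.ofInjective hinj x : S) : G) = g⁻¹ * ((x : S) : G) * g := hg x
      rw [h1, h2]
      group

/-- `P ≤ S` is strongly `F`-closed: for every subgroup `R` of `P` and every morphism
`φ : R → S` of `F`, one has `φ(R) ≤ P`. -/
def IsStronglyClosed {S : Type*} [Group S] (F : FusionSystem S) (P : Subgroup S) : Prop :=
  ∀ R : Subgroup S, R ≤ P → ∀ φ ∈ F.Hom R ⊤, ∀ x : R, (φ x : S) ∈ P

/-- `F` is supersolvable: there is a series `1 = S_0 ≤ S_1 ≤ ... ≤ S_n = S` of strongly `F`-closed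
subgroups of `S` such that each `S_{i+1} / S_i` is cyclic. (A strongly `F`-closed subgroup is
invariant under conjugation in `S`, so the normality of `S_i` in `S_{i+1}` is automatic; it is
mentioned only to form the quotient group.) -/
def IsSupersolvable {S : Type*} [Group S] (F : FusionSystem S) : Prop :=
  ∃ (n : ℕ) (c : Fin (n + 1) → Subgroup S), c 0 = ⊥ ∧ c (Fin.last n) = ⊤ ∧
    (∀ i, F.IsStronglyClosed (c i)) ∧
    ∀ i : Fin n, c i.castSucc ≤ c i.succ ∧
      ∃ _ : ((c i.castSucc).subgroupOf (c i.succ)).Normal,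
        IsCyclic (c i.succ ⧸ (c i.castSucc).subgroupOf (c i.succ))

end FusionSystem

/-! The point is that G is p-nilpotent: G = SN with N a normal p-complement. Then a G-conjugation
between subgroups of S agrees with an S-conjugation, because the N-part contributes only a
commutator in S ∩ N = 1. Normal subgroups of S are therefore strongly closed, and a normal series of
the p-group S with cyclic factors suffices.

For A of order p, Φ(A) = 1 and A_{sG} is 1 or A. So either A is S-permutable or its supplement T is
a complement of index p, normal because p is the smallest prime divisor of |G|. If G has any normal
subgroup of index p, induct into it. Otherwise every A ≤ S of order p is S-permutable; since exp(S)
= p, these A cover S, which makes S normal and centralized by every Sylow q-subgroup with q ≠ p.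
Then S is a direct factor. -/

/-- A group is `p`-nilpotent when its elements of order prime to `p` form a subgroup. -/
def IsPNilpotent (p : ℕ) (G : Type*) [Group G] : Prop :=
  ∃ N : Subgroup G, ∀ x, x ∈ N ↔ ¬ p ∣ orderOf x

/-! ### Elements of order prime to p and p-nilpotence -/

theorem IsPGroup.eq_one_of_not_dvd_orderOf {G : Type*} [Group G] {p : ℕ} (hp : p.Prime)
    (hG : IsPGroup p G) {x : G} (hx : ¬ p ∣ orderOf x) : x = 1 := by
  obtain ⟨k, hk⟩ := hG x
  have h := orderOf_dvd_of_pow_eq_one hk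
  exact orderOf_eq_one_iff.mp
    (Nat.Coprime.eq_one_of_dvd (((Nat.Prime.coprime_iff_not_dvd hp).mpr hx).symm.pow_right k) h)

theorem Subgroup.mem_of_isPGroup_quotient {G : Type*} [Group G] {p : ℕ} (hp : p.Prime)
    (N : Subgroup G) [N.Normal] (hN : IsPGroup p (G ⧸ N)) {x : G} (hx : ¬ p ∣ orderOf x) :
    x ∈ N :=
  (QuotientGroup.eq_one_iff x).mp (hN.eq_one_of_not_dvd_orderOf hp
    fun h => hx (h.trans (orderOf_map_dvd (QuotientGroup.mk' N) x)))

theorem Subgroup.isPGroup_quotient_of_forall_mem {G : Type*} [Group G] [Finite G] {p : ℕ}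
    (hp : p.Prime) (N : Subgroup G) [N.Normal] (hN : ∀ x : G, ¬ p ∣ orderOf x → x ∈ N) :
    IsPGroup p (G ⧸ N) := by
  intro y
  obtain ⟨y, rfl⟩ := QuotientGroup.mk_surjective y
  obtain ⟨k, m, hm, h⟩ := Nat.exists_eq_pow_mul_and_not_dvd (orderOf_pos y).ne' p hp.ne_one
  refine ⟨k, ?_⟩
  rw [← QuotientGroup.mk_pow, QuotientGroup.eq_one_iff]
  apply hN
  rwa [orderOf_pow_of_dvd (pow_ne_zero _ hp.ne_zero) ⟨m, h⟩, h,
    Nat.mul_div_cancel_left _ (pow_pos hp.pos k)]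

theorem Sylow.exists_mul_of_forall_mem {G : Type*} [Group G] [Finite G] {p : ℕ}
    (hp : p.Prime) (S : Sylow p G) (N : Subgroup G) [N.Normal]
    (hN : ∀ x : G, ¬ p ∣ orderOf x → x ∈ N) (g : G) : ∃ s ∈ S, ∃ n ∈ N, s * n = g := by
  have := Fact.mk hp
  have h1 : ((S : Subgroup G) ⊔ N).index = 1 := by
    obtain ⟨k, hk⟩ := IsPGroup.iff_card.mp (N.isPGroup_quotient_of_forall_mem hp hN)
    have h2 : ((S : Subgroup G) ⊔ N).index ∣ p ^ k := by
      rw [← hk]; exact Subgroup.index_dvd_of_le le_sup_right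
    have h3 : ¬ p ∣ ((S : Subgroup G) ⊔ N).index := fun h =>
      S.not_dvd_index (h.trans (Subgroup.index_dvd_of_le le_sup_left))
    exact Nat.Coprime.eq_one_of_dvd
      (((Nat.Prime.coprime_iff_not_dvd hp).mpr h3).symm.pow_right k) h2
  have hg : g ∈ (S : Subgroup G) ⊔ N := by
    rw [Subgroup.index_eq_one.mp h1]; trivial
  exact Subgroup.mem_sup_of_normal_right.mp hg

theorem IsPNilpotent.of_normal {G : Type*} [Group G] {p : ℕ} (hp : p.Prime)
    {T : Subgroup G} [T.Normal] (hT : T.index = p) (h : IsPNilpotent p T) :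
    IsPNilpotent p G := by
  obtain ⟨N, hN⟩ := h
  refine ⟨N.map T.subtype, fun x => ⟨?_, fun hx => ?_⟩⟩
  · rintro ⟨y, hy, rfl⟩
    simpa using (hN y).mp hy
  · have hxT : x ∈ T := T.mem_of_isPGroup_quotient hp
      (IsPGroup.of_card (n := 1) (by rw [pow_one]; exact hT)) hx
    exact ⟨⟨x, hxT⟩, (hN _).mpr (by simpa using hx), rfl⟩

/-- The centralizer C of S contains every Sylow q-subgroup with q ≠ p, so G/C is a p-group. A
Schur–Zassenhaus complement K to S lies in C, and K is the required set of p'-elements. -/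
theorem Sylow.isPNilpotent_of_normal {G : Type*} [Group G] [Finite G] {p : ℕ} (hp : p.Prime)
    (S : Sylow p G) [(S : Subgroup G).Normal]
    (hS : ∀ q : ℕ, q.Prime → q ≠ p → ∀ Q : Sylow q G,
      (Q : Subgroup G) ≤ Subgroup.centralizer (S : Set G)) :
    IsPNilpotent p G := by
  have := Fact.mk hp
  set C := Subgroup.centralizer (S : Set G) with hC
  have : C.Normal := Subgroup.normal_centralizer (H := (S : Subgroup G))
  have hpC : IsPGroup p (G ⧸ C) := by
    refine IsPGroup.iff_card.mpr ⟨C.index.primeFactorsList.length,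
      Nat.eq_prime_pow_of_unique_prime_dvd Subgroup.index_ne_zero_of_finite ?_⟩
    intro q hq hqC
    by_contra hne
    have := Fact.mk hq
    obtain ⟨Q⟩ : Nonempty (Sylow q G) := inferInstance
    exact Q.not_dvd_index (hqC.trans (Subgroup.index_dvd_of_le (hS q hq hne Q)))
  obtain ⟨K, hK⟩ := Subgroup.exists_right_complement'_of_coprime S.card_coprime_index
  have hKcard : ¬ p ∣ Nat.card K := by
    rw [← hK.symm.index_eq_card]
    exact S.not_dvd_index
  have hKord : ∀ x ∈ K, ¬ p ∣ orderOf x := fun x hx h =>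
    hKcard (h.trans (Subgroup.orderOf_dvd_natCard K hx))
  have hKC : K ≤ C := fun x hx => C.mem_of_isPGroup_quotient hp hpC (hKord x hx)
  refine ⟨K, fun x => ⟨hKord x, fun hx => ?_⟩⟩
  have hxC : x ∈ C := C.mem_of_isPGroup_quotient hp hpC hx
  obtain ⟨⟨s, k⟩, rfl⟩ := hK.surjective x
  have hsC : (s : G) ∈ C := (C.mul_mem_cancel_right (hKC k.2)).mp hxC
  have hcomm : Commute (s : G) (k : G) := (Subgroup.mem_centralizer_iff.mp (hKC k.2)) s s.2
  have hs : s = 1 := by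
    refine IsPGroup.eq_one_of_not_dvd_orderOf hp S.isPGroup' fun h => hx ?_
    -- Commuting factors of coprime orders: the order of s divides that of sk.
    have hcop : Nat.Coprime (orderOf (s : G)) (orderOf (k : G)) := by
      obtain ⟨n, hn⟩ := IsPGroup.iff_orderOf.mp S.isPGroup' s
      rw [Subgroup.orderOf_coe, hn]
      exact ((Nat.Prime.coprime_iff_not_dvd hp).mpr (hKord _ k.2)).pow_left n
    rw [hcomm.orderOf_mul_eq_mul_orderOf_of_coprime hcop, Subgroup.orderOf_coe]
    exact h.mul_right _
  simp [hs]

/-! ### S-permutable subgroups of order p -/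

/-- Q acts on A through Aut(A), of order p - 1, which is prime to q since q > p. -/
theorem Subgroup.le_centralizer_of_card_prime {G : Type*} [Group G] [Finite G] {p q : ℕ}
    (hp : p.Prime) (hq : q.Prime) (hpq : p < q) {A Q : Subgroup G} (hA : Nat.card A = p)
    (hQ : IsPGroup q Q) (hQA : Q ≤ normalizer (A : Set G)) : Q ≤ centralizer (A : Set G) := by
  intro x hx
  have := Fact.mk hp
  have := Fact.mk hq
  have := isCyclic_of_prime_card hA
  have h1 : A.normalizerMonoidHom ⟨x, hQA hx⟩ = 1 := by
    rw [← orderOf_eq_one_iff]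
    have h2 := _root_.orderOf_dvd_natCard (A.normalizerMonoidHom ⟨x, hQA hx⟩)
    rw [IsCyclic.card_mulAut, hA, Nat.totient_prime hp] at h2
    obtain ⟨n, hn⟩ := hQ ⟨x, hx⟩
    have h3 : orderOf (A.normalizerMonoidHom ⟨x, hQA hx⟩) ∣ q ^ n := by
      apply orderOf_dvd_of_pow_eq_one
      rw [← map_pow, show (⟨x, hQA hx⟩ : normalizer (A : Set G)) ^ q ^ n = 1 from
        Subtype.ext (congrArg (fun y : Q => (y : G)) hn), map_one]
    have h4 : Nat.Coprime q (p - 1) := (Nat.Prime.coprime_iff_not_dvd hq).mpr fun h =>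
      absurd (Nat.le_of_dvd (Nat.sub_pos_of_lt hp.one_lt) h) (by omega)
    exact Nat.eq_one_of_dvd_coprimes (h4.pow_left n) h3 h2
  rw [← MonoidHom.mem_ker, normalizerMonoidHom_ker] at h1
  exact h1

/-- AP = PA is a subgroup, and its order is |P| times the length of an A-orbit on G/P, a power of p.
Maximality of P gives AP = P. -/
theorem Subgroup.IsSPermutable.le_sylow {G : Type*} [Group G] [Finite G] {p : ℕ}
    (hp : p.Prime) {A : Subgroup G} (hA : IsPGroup p A) (h : A.IsSPermutable) (P : Sylow p G) :
    A ≤ P := by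
  have := Fact.mk hp
  have key := h p hp P
  have hmul : ∀ {x y : G}, x ∈ (A : Set G) * ((P : Subgroup G) : Set G) →
      y ∈ (A : Set G) * ((P : Subgroup G) : Set G) →
      x * y ∈ (A : Set G) * ((P : Subgroup G) : Set G) := by
    intro x y hx hy
    have hxy := Set.mul_mem_mul hx hy
    rwa [mul_assoc, ← mul_assoc _ (A : Set G), ← key, mul_assoc (A : Set G),
      coe_mul_coe, ← mul_assoc, coe_mul_coe] at hxy
  let H : Subgroup G :=
    { carrier := (A : Set G) * ((P : Subgroup G) : Set G)
      mul_mem' := hmul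
      one_mem' := ⟨1, one_mem _, 1, one_mem _, mul_one 1⟩
      inv_mem' := by
        rintro _ ⟨a, ha, b, hb, rfl⟩
        rw [key]
        exact ⟨b⁻¹, inv_mem hb, a⁻¹, inv_mem ha, (mul_inv_rev a b).symm⟩ }
  have hH : IsPGroup p H := by
    obtain ⟨m, hm⟩ := IsPGroup.iff_card.mp P.isPGroup'
    obtain ⟨k, hk⟩ := hA.card_orbit ((1 : G) : G ⧸ (P : Subgroup G))
    refine IsPGroup.of_card (n := m + k) ?_
    have hcard := card_mul_eq_card_subgroup_mul_card_quotient (P : Subgroup G) (A : Set G)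
    have horbit : (QuotientGroup.mk '' (A : Set G) : Set (G ⧸ (P : Subgroup G))) =
        MulAction.orbit A ((1 : G) : G ⧸ (P : Subgroup G)) := by
      ext y
      constructor
      · rintro ⟨a, ha, rfl⟩
        exact ⟨⟨a, ha⟩, congrArg QuotientGroup.mk (mul_one a)⟩
      · rintro ⟨a, rfl⟩
        exact ⟨a, a.2, congrArg QuotientGroup.mk (mul_one (a : G)).symm⟩
    rw [pow_add, ← hm, ← hk, ← horbit]
    exact hcard
  have hPH : (P : Subgroup G) ≤ H := fun b hb => ⟨1, one_mem _, b, hb, one_mul b⟩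
  rw [← P.is_maximal' hH hPH]
  exact fun a ha => ⟨a, ha, 1, one_mem _, mul_one a⟩

theorem Subgroup.IsSPermutable.subgroupOf {G : Type*} [Group G] {T : Subgroup G}
    {B : Subgroup T} (h : (B.map T.subtype).IsSPermutable) : B.IsSPermutable := by
  intro q hq Q
  obtain ⟨R, hR⟩ := Q.exists_comap_subtype_eq
  have hRQ : ∀ t : T, (t : G) ∈ R ↔ t ∈ Q := fun t => by
    change _ ↔ t ∈ (Q : Subgroup T); rw [← hR]; rfl
  have key := h q hq R
  ext x
  constructor
  · rintro ⟨b, hb, t, ht, rfl⟩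
    have : (b * t : G) ∈ ((R : Subgroup G) : Set G) * (B.map T.subtype : Set G) :=
      key ▸ Set.mul_mem_mul ⟨b, hb, rfl⟩ ((hRQ t).mpr ht)
    obtain ⟨r, hr, _, ⟨c, hc, rfl⟩, hrc⟩ := this
    refine ⟨b * t * c⁻¹, (hRQ _).mp ?_, c, hc, by simp⟩
    have : ((b * t * c⁻¹ : T) : G) = r := by
      simpa [mul_inv_eq_iff_eq_mul] using hrc.symm
    rwa [this]
  · rintro ⟨t, ht, b, hb, rfl⟩
    have : (t * b : G) ∈ (B.map T.subtype : Set G) * ((R : Subgroup G) : Set G) :=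
      key ▸ Set.mul_mem_mul ((hRQ t).mpr ht) ⟨b, hb, rfl⟩
    obtain ⟨_, ⟨c, hc, rfl⟩, r, hr, hrc⟩ := this
    refine ⟨c, hc, c⁻¹ * (t * b), (hRQ _).mp ?_, by simp⟩
    have : ((c⁻¹ * (t * b) : T) : G) = r := by
      simpa [inv_mul_eq_iff_eq_mul] using hrc.symm
    rwa [this]

theorem Subgroup.IsSPermutable.le_centralizer {G : Type*} [Group G] [Finite G] {p q : ℕ}
    (hp : p.Prime) (hq : q.Prime) (hpq : p < q) (S : Sylow p G) [(S : Subgroup G).Normal]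
    {A : Subgroup G} (hAS : A ≤ S) (hA : Nat.card A = p) (h : A.IsSPermutable)
    (Q : Sylow q G) : (Q : Subgroup G) ≤ centralizer (A : Set G) := by
  have := Fact.mk hp
  have := Fact.mk hq
  refine le_centralizer_of_card_prime hp hq hpq hA Q.isPGroup' fun x hx => ?_
  have hdisj : Disjoint (S : Subgroup G) Q :=
    IsPGroup.disjoint_of_ne p q hpq.ne _ _ S.isPGroup' Q.isPGroup'
  have key : ∀ y ∈ Q, ∀ a ∈ A, y⁻¹ * a * y ∈ A := by
    intro y hy a ha
    have h1 : a * y ∈ ((Q : Subgroup G) : Set G) * (A : Set G) :=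
      h q hq Q ▸ Set.mul_mem_mul ha hy
    -- From ay = zb, the element y⁻¹z lies in Q ∩ S = 1, so y⁻¹ay = b.
    obtain ⟨z, hz, b, hb, hzb : z * b = a * y⟩ := h1
    have h2 : y⁻¹ * z = (y⁻¹ * a * y) * b⁻¹ := by
      rw [mul_assoc y⁻¹, ← hzb]; group
    have h3 : y⁻¹ * z ∈ (S : Subgroup G) := by
      rw [h2]
      refine mul_mem ?_ (inv_mem (hAS hb))
      simpa using (inferInstance : (S : Subgroup G).Normal).conj_mem a (hAS ha) y⁻¹
    have h4 : y⁻¹ * z = 1 := disjoint_def.mp hdisj h3 (mul_mem (inv_mem hy) hz)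
    rw [h4, eq_comm, mul_inv_eq_one] at h2
    rwa [h2]
  rw [mem_normalizer_iff]
  refine fun a => ⟨fun ha => by simpa using key x⁻¹ (inv_mem hx) a ha, fun ha => ?_⟩
  have := key x hx _ ha
  simpa [mul_assoc] using this

/-! ### p-nilpotence of G -/

theorem Sylow.isPNilpotent_of_forall_isSPermutable {G : Type*} [Group G] [Finite G] {p : ℕ}
    (hp : p.Prime) (hmin : ∀ q : ℕ, q.Prime → q ∣ Nat.card G → p ≤ q) (S : Sylow p G)
    (hexp : ∀ x ∈ S, x ^ p = 1)
    (h : ∀ A : Subgroup G, Nat.card A = p → A ≤ S → A.IsSPermutable) : IsPNilpotent p G := by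
  have := Fact.mk hp
  have hz : ∀ x ∈ S, x = 1 ∨ Nat.card (Subgroup.zpowers x) = p := fun x hx => by
    rw [Nat.card_zpowers, ← orderOf_eq_one_iff]
    exact (Nat.dvd_prime hp).mp (orderOf_dvd_of_pow_eq_one (hexp x hx))
  have hle : ∀ x ∈ S, Subgroup.zpowers x ≤ S := fun x hx => by
    rw [Subgroup.zpowers_le]; exact hx
  have hSP : ∀ P : Sylow p G, (S : Subgroup G) ≤ P := by
    intro P x hx
    rcases hz x hx with rfl | hc
    · exact one_mem _
    · exact (h _ hc (hle x hx)).le_sylow hp (IsPGroup.of_card (n := 1) (by rw [hc, pow_one])) P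
        (Subgroup.mem_zpowers x)
  have : (S : Subgroup G).Normal := by
    refine ⟨fun x hx g => ?_⟩
    have := hSP (g⁻¹ • S) hx
    rw [Sylow.coe_subgroup_smul, Subgroup.mem_pointwise_smul_iff_inv_smul_mem] at this
    simpa [MulAut.smul_def] using this
  refine S.isPNilpotent_of_normal hp fun q hq hne Q => ?_
  have := Fact.mk hq
  by_cases hqG : q ∣ Nat.card G
  · have hpq : p < q := lt_of_le_of_ne (hmin q hq hqG) hne.symm
    intro y hy
    rw [Subgroup.mem_centralizer_iff]
    intro x hx
    rcases hz x hx with rfl | hc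
    · simp
    · exact Subgroup.mem_centralizer_iff.mp ((h _ hc (hle x hx)).le_centralizer hp hq hpq S
        (hle x hx) hc Q hy) x (Subgroup.mem_zpowers x)
  · have hQ : (Q : Subgroup G) = ⊥ := by
      obtain ⟨n, hn⟩ := IsPGroup.iff_card.mp Q.isPGroup'
      rw [← Subgroup.card_eq_one, hn]
      rcases n with _ | n
      · rfl
      · exact absurd (((dvd_pow_self q n.succ_ne_zero).trans (dvd_of_eq hn.symm)).trans
          (Subgroup.card_subgroup_dvd_card _)) hqG
    rw [hQ]; exact bot_le

/-- The dichotomy is stated in this form because it passes to any normal subgroup T of index p, so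
the induction need not relate T to a particular A. -/
theorem Sylow.isPNilpotent_of_isSPermutable_or_complement {p : ℕ} (hp : p.Prime) (n : ℕ) :
    ∀ {G : Type*} [Group G] [Finite G] (_ : Nat.card G = n)
      (_ : ∀ q : ℕ, q.Prime → q ∣ Nat.card G → p ≤ q) (S : Sylow p G)
      (_ : ∀ x ∈ S, x ^ p = 1)
      (_ : ∀ A : Subgroup G, Nat.card A = p → A ≤ S →
        A.IsSPermutable ∨ ∃ T : Subgroup G, T.Normal ∧ T.index = p ∧ A ⊓ T = ⊥),
      IsPNilpotent p G := by
  have := Fact.mk hp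
  induction n using Nat.strong_induction_on with
  | _ n ih =>
  intro G _ _ hn hmin S hexp h
  by_cases hT : ∃ T : Subgroup G, T.Normal ∧ T.index = p
  · obtain ⟨T, hTn, hTi⟩ := hT
    refine IsPNilpotent.of_normal hp hTi ?_
    have hcard := T.card_mul_index
    have hlt : Nat.card T < n := by
      rw [hTi, hn] at hcard
      rw [← hcard]
      exact lt_mul_of_one_lt_right Nat.card_pos hp.one_lt
    -- S ∩ T is Sylow in T: compare the two factorizations of the index of S ∩ T in G.
    have hST : ¬ p ∣ ((S : Subgroup G).subgroupOf T).index := fun hd => by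
      have h1 := Subgroup.relIndex_mul_index (inf_le_right : (S : Subgroup G) ⊓ T ≤ T)
      have h2 := Subgroup.relIndex_mul_index (inf_le_left : (S : Subgroup G) ⊓ T ≤ S)
      rw [Subgroup.inf_relIndex_right, ← h2, Subgroup.inf_relIndex_left, hTi] at h1
      have h3 : T.relIndex S ∣ p := hTi ▸ T.relIndex_dvd_index_of_normal S
      refine S.not_dvd_index (Nat.dvd_of_mul_dvd_mul_left hp.pos ?_)
      exact ((mul_dvd_mul_right hd p).trans (dvd_of_eq h1)).trans (mul_dvd_mul_right h3 _)
    let S' : Sylow p T := IsPGroup.toSylow (P := (S : Subgroup G).subgroupOf T)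
      (S.isPGroup'.comap_of_injective T.subtype T.subtype_injective) hST
    have hS' : ∀ x, x ∈ S' ↔ (x : G) ∈ S := fun x => Iff.rfl
    refine ih _ hlt rfl
      (fun q hq hd => hmin q hq (hd.trans (Subgroup.card_subgroup_dvd_card _))) S'
      (fun x hx => Subtype.ext (by simpa using hexp x ((hS' x).mp hx))) fun B hB hBS => ?_
    have hBc : Nat.card (B.map T.subtype) = p := by
      rw [Subgroup.card_map_of_injective T.subtype_injective, hB]
    have hBle : B.map T.subtype ≤ S := by
      rintro _ ⟨b, hb, rfl⟩
      exact (hS' b).mp (hBS hb)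
    refine (h _ hBc hBle).imp (fun h => h.subgroupOf) ?_
    rintro ⟨K, hKn, hKi, hBK⟩
    have hbot : B ⊓ K.subgroupOf T = ⊥ := by
      rw [eq_bot_iff]
      rintro b ⟨hb, hbK⟩
      have : (b : G) ∈ B.map T.subtype ⊓ K := ⟨⟨b, hb, rfl⟩, hbK⟩
      rw [hBK] at this
      exact Subtype.ext this
    refine ⟨K.subgroupOf T, inferInstance, ?_, hbot⟩
    -- Index 1 would mean T ≤ K, forcing B = B ∩ K = 1.
    have hd : (K.subgroupOf T).index ∣ p := hKi ▸ K.relIndex_dvd_index_of_normal T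
    refine ((Nat.dvd_prime hp).mp hd).resolve_left fun h1 => ?_
    rw [Subgroup.index_eq_one.mp h1, inf_top_eq] at hbot
    rw [hbot, Subgroup.card_bot] at hB
    exact hp.one_lt.ne hB
  · exact S.isPNilpotent_of_forall_isSPermutable hp hmin hexp fun A hA hAS =>
      (h A hA hAS).resolve_right fun ⟨T, hTn, hTi, _⟩ => hT ⟨T, hTn, hTi⟩

theorem Subgroup.IsWeaklySPhiSupplemented.isSPermutable_or_complement {G : Type*} [Group G]
    [Finite G] {p : ℕ} (hp : p.Prime) (hmin : ∀ q : ℕ, q.Prime → q ∣ Nat.card G → p ≤ q)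
    {A : Subgroup G} (hA : Nat.card A = p) (h : A.IsWeaklySPhiSupplemented) :
    A.IsSPermutable ∨ ∃ T : Subgroup G, T.Normal ∧ T.index = p ∧ A ⊓ T = ⊥ := by
  have := Fact.mk hp
  have hle : ∀ B ≤ A, B = ⊥ ∨ B = A := fun B hB => by
    rcases (Nat.dvd_prime hp).mp (hA ▸ card_dvd_of_le hB) with h1 | h1
    · exact Or.inl (card_eq_one.mp h1)
    · exact Or.inr (eq_of_le_of_card_ge hB (by rw [h1, hA]))
  by_cases hperm : A.IsSPermutable
  · exact Or.inl hperm
  · right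
    obtain ⟨T, hAT, hint⟩ := h
    have hcore : A.sPermCore = ⊥ := by
      rw [sPermCore, sSup_eq_bot]
      rintro B ⟨hBA, hB⟩
      exact (hle B hBA).resolve_right fun h => hperm (h ▸ hB)
    have hfrat : A.frattiniIn = ⊥ := by
      have : IsSimpleGroup A := isSimpleGroup_of_prime_card hA
      have : Nontrivial A := inferInstance
      have hne : frattini A ≠ ⊤ := fun h => by
        obtain h' := frattini_nongenerating (K := (⊥ : Subgroup A)) (by rw [h]; simp)
        exact bot_ne_top h'
      have : frattini A = ⊥ := ((inferInstance : (frattini A).Normal).eq_bot_or_eq_top).resolve_right hne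
      rw [frattiniIn, this, map_bot]
    have hbot : A ⊓ T = ⊥ := by
      rw [hcore, hfrat] at hint
      rw [eq_bot_iff]
      intro x hx
      simpa using hint hx
    have hcompl : IsComplement' A T :=
      isComplement'_of_disjoint_and_mul_eq_univ (disjoint_iff.mpr hbot) hAT
    have hindex : T.index = p := by rw [hcompl.index_eq_card, hA]
    refine ⟨T, normal_of_index_eq_minFac_card ?_, hindex, hbot⟩
    have hpG : p ∣ Nat.card G := hA ▸ card_subgroup_dvd_card A
    rw [hindex]
    exact le_antisymm (hmin _ (Nat.minFac_prime fun h1 => hp.one_lt.ne' (Nat.dvd_one.mp (h1 ▸ hpG)))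
      (Nat.minFac_dvd _)) (Nat.minFac_le_of_dvd hp.two_le hpG)

/-! ### Strongly closed subgroups and normal series -/

theorem IsPNilpotent.isStronglyClosed_of_normal {G : Type*} [Group G] [Finite G] {p : ℕ}
    (hp : p.Prime) (hG : IsPNilpotent p G) (S : Sylow p G) (P : Subgroup (S : Subgroup G))
    [P.Normal] : (FusionSystem.ofSubgroup (S : Subgroup G)).IsStronglyClosed P := by
  obtain ⟨N, hN⟩ := hG
  have : N.Normal := ⟨fun x hx g => by
    rw [hN] at hx ⊢
    rwa [← MulAut.conj_apply, MulEquiv.orderOf_eq]⟩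
  rintro R hR φ ⟨g, hg⟩ x
  obtain ⟨s, hs, n, hn, rfl⟩ := S.exists_mul_of_forall_mem hp N (fun x hx => (hN x).mpr hx) g
  set y : (S : Subgroup G) := ⟨s, hs⟩⁻¹ * x * ⟨s, hs⟩ with hy
  have hyP : y ∈ P := by
    simpa using (inferInstance : P.Normal).conj_mem x (hR x.2) (⟨s, hs⟩⁻¹)
  have hφ : ((φ x : (S : Subgroup G)) : G) = n⁻¹ * y * n := by
    rw [hg, hy]; push_cast; group
  -- This element is the commutator n⁻¹(yny⁻¹), which lies in S ∩ N = 1.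
  have h1 : (φ x : (S : Subgroup G)) * y⁻¹ = 1 := by
    refine S.isPGroup'.eq_one_of_not_dvd_orderOf hp ?_
    rw [← Subgroup.orderOf_coe, ← hN]
    have : (((φ x : (S : Subgroup G)) * y⁻¹ : (S : Subgroup G)) : G)
        = n⁻¹ * (y * n * (y : G)⁻¹) := by
      push_cast; rw [hφ]; group
    rw [this]
    exact mul_mem (inv_mem hn) ((inferInstance : N.Normal).conj_mem n hn y)
  rwa [mul_inv_eq_one.mp h1]

/-- L is the preimage of the cyclic group generated by a nontrivial central element of S/M. -/
theorem IsPGroup.exists_normal_gt_isCyclic {S : Type*} [Group S] [Finite S] {p : ℕ}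
    [Fact p.Prime] (hS : IsPGroup p S) (M : Subgroup S) [M.Normal] (hM : M ≠ ⊤) :
    ∃ L : Subgroup S, L.Normal ∧ M < L ∧ IsCyclic (L ⧸ M.subgroupOf L) := by
  have : Nontrivial (S ⧸ M) := QuotientGroup.nontrivial_iff.mpr hM
  have := (hS.to_quotient M).center_nontrivial
  obtain ⟨⟨z, hzc⟩, hz⟩ := exists_ne (1 : Subgroup.center (S ⧸ M))
  obtain ⟨g, rfl⟩ := QuotientGroup.mk'_surjective M z
  have : (Subgroup.zpowers (QuotientGroup.mk' M g)).Normal :=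
    ⟨fun x hx k => by
      have hxc := (Subgroup.zpowers_le.mpr hzc) hx
      rwa [Subgroup.mem_center_iff.mp hxc k, mul_inv_cancel_right]⟩
  set L := (Subgroup.zpowers (QuotientGroup.mk' M g)).comap (QuotientGroup.mk' M) with hL
  have hgL : g ∈ L := Subgroup.mem_zpowers (QuotientGroup.mk' M g)
  have hML : M ≤ L := by
    intro x hx
    have h1 : QuotientGroup.mk' M x = 1 := (QuotientGroup.eq_one_iff x).mpr hx
    rw [hL, Subgroup.mem_comap, h1]
    exact one_mem _
  refine ⟨L, inferInstance, lt_of_le_of_ne hML fun h => hz (Subtype.ext ?_),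
    ⟨QuotientGroup.mk ⟨g, hgL⟩, fun x => ?_⟩⟩
  · exact (QuotientGroup.eq_one_iff g).mpr (h ▸ hgL)
  · obtain ⟨⟨x, hx⟩, rfl⟩ := QuotientGroup.mk_surjective x
    obtain ⟨k, hk⟩ := hx
    refine ⟨k, ?_⟩
    change ((⟨g, hgL⟩ : L) : L ⧸ M.subgroupOf L) ^ k = _
    rw [← QuotientGroup.mk_zpow, QuotientGroup.eq, Subgroup.mem_subgroupOf]
    change ((g : S ⧸ M)) ^ k = _ at hk
    rw [← QuotientGroup.mk_zpow] at hk
    exact QuotientGroup.eq.mp hk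

theorem IsPGroup.exists_normal_series {S : Type*} [Group S] [Finite S] {p : ℕ}
    [Fact p.Prime] (hS : IsPGroup p S) (M : Subgroup S) (hM : M.Normal) :
    ∃ (n : ℕ) (c : Fin (n + 1) → Subgroup S), c 0 = M ∧ c (Fin.last n) = ⊤ ∧
      (∀ i, (c i).Normal) ∧ ∀ i : Fin n, c i.castSucc ≤ c i.succ ∧
        ∃ _ : ((c i.castSucc).subgroupOf (c i.succ)).Normal, IsCyclic (c i.succ ⧸ (c i.castSucc).subgroupOf (c i.succ)) := by
  induction M using WellFoundedGT.induction with
  | _ M ih =>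
  by_cases hMtop : M = ⊤
  · exact ⟨0, fun _ => M, rfl, hMtop, fun _ => hM, fun i => i.elim0⟩
  · obtain ⟨L, hLn, hML, hcyc⟩ := hS.exists_normal_gt_isCyclic M hMtop
    obtain ⟨n, c, h0, hl, hn, hc⟩ := ih L hML hLn
    subst h0
    refine ⟨n + 1, Fin.cons M c, rfl, ?_, ?_, ?_⟩
    · rw [← Fin.succ_last, Fin.cons_succ, hl]
    · exact Fin.cases hM hn
    · exact Fin.cases ⟨hML.le, hM.subgroupOf _, hcyc⟩ hc

theorem theorem66666 {G : Type*} [Group G] [Finite G] (p : ℕ) (hp : p.Prime)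
    (hpG : p ∣ Nat.card G) (hmin : ∀ q : ℕ, q.Prime → q ∣ Nat.card G → p ≤ q)
    (S : Sylow p G) (hexp : Monoid.exponent (S : Subgroup G) = p)
    (hsupp : ∀ A : Subgroup G, IsAtom A → A ≤ (S : Subgroup G) → A.IsWeaklySPhiSupplemented) :
    (FusionSystem.ofSubgroup (S : Subgroup G)).IsSupersolvable := by
  have := Fact.mk hp
  have hnil : IsPNilpotent p G := by
    refine Sylow.isPNilpotent_of_isSPermutable_or_complement hp _ rfl hmin S
      (fun x hx => ?_) fun A hA hAS => ?_
    · have h := Monoid.pow_exponent_eq_one (⟨x, hx⟩ : (S : Subgroup G))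
      rw [hexp] at h
      exact congrArg Subtype.val h
    · refine (hsupp A ⟨?_, fun B hB => ?_⟩ hAS).isSPermutable_or_complement hp hmin hA
      · rintro rfl
        rw [Subgroup.card_bot] at hA
        exact hp.one_lt.ne hA
      · rcases (Nat.dvd_prime hp).mp (hA ▸ Subgroup.card_dvd_of_le hB.le) with h1 | h1
        · exact Subgroup.card_eq_one.mp h1
        · exact absurd (Subgroup.eq_of_le_of_card_ge hB.le (by rw [h1, hA])) hB.ne
  obtain ⟨n, c, h0, hl, hn, hc⟩ := S.isPGroup'.exists_normal_series ⊥ inferInstance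
  refine ⟨n, c, h0, hl, fun i => ?_, hc⟩
  have := hn i
  exact hnil.isStronglyClosed_of_normal hp S (c i)
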